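/- Let $k$ be a field, $n\ge 2$, and $A=k[x_1,\ldots,x_n]$. Let $a_{i,j}$ ($1\le i,j\le n$) be positive integers with $a_{i,i}=\sum_{j\ne i}a_{i,j}$ for every $i$. For $j=1,\ldots,n$ put $$f_j=x_j^{a_{j,j}}-\prod_{i\ne j}x_i^{a_{i,j}},$$ and let $I=(f_1,\ldots,f_n)$ (a positive critical binomial, or PCB, ideal) and $J=(f_1,\ldots,f_{n-1})$. Let $b(n)=(b_1,\ldots,b_n)$, where $b_1=b_n=0$ and $b_i=a_{i,i}-\sum_{j=i+1}^{n}a_{i,j}$ for $1<i<n$, and write $x^{b(n)}=x_1^{b_1}\cdots x_n^{b_n}$. Let $B=k[x_1^{\pm1},\ldots,x_n^{\pm1}]$ be the localization of $A$ at the powers of $x_1\cdots x_n$, let $S(I)=IB\cap A$, and let $\operatorname{hull}(I)$ be the intersection of the isolated primary components of $I$, i.e. of those components of a minimal primary decomposition of $I$ whose radical is a minimal prime over $I$. Then $$S(I)=\operatorname{hull}(I)=I:x^{b(n)}=J:x^{b(n)}.$$ -/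

import Mathlib

open scoped BigOperators

namespace PCB

section Matrices

/-- The positive integers `a i j` (`0`-based indices) are the absolute values of the entries of an
`n × n` positive critical binomial matrix `L` (with `L i i = a i i` and `L i j = - a i j` for
`i ≠ j`): all of them are positive and every row of `L` sums to zero. -/
structure IsPCB {n : ℕ} (a : Matrix (Fin n) (Fin n) ℕ) : Prop where
  pos : ∀ i j, 0 < a i j
  diag : ∀ i, a i i = ∑ j ∈ Finset.univ.erase i, a i j

/-- The exponent vector
`b(n) = (0, a₂₂ - a₂₃ - ⋯ - a₂ₙ, …, aₙ₋₁,ₙ₋₁ - aₙ₋₁,ₙ, 0)`: the first and the last entries are `0`,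
and each other entry is `aᵢᵢ - ∑_{j > i} aᵢⱼ`. The subtraction in `ℕ` does not truncate for the
matrices at hand, see `IsPCB.cast_bLast`. -/
def bLast {n : ℕ} (a : Matrix (Fin n) (Fin n) ℕ) (i : Fin n) : ℕ :=
  if (i : ℕ) = 0 ∨ (i : ℕ) + 1 = n then 0 else a i i - ∑ j ∈ Finset.univ.filter (i < ·), a i j

theorem IsPCB.cast_bLast {n : ℕ} {a : Matrix (Fin n) (Fin n) ℕ} (ha : IsPCB a) (i : Fin n)
    (h0 : (i : ℕ) ≠ 0) (hn : (i : ℕ) + 1 ≠ n) :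
    (bLast a i : ℤ) = (a i i : ℤ) - ∑ j ∈ Finset.univ.filter (i < ·), (a i j : ℤ) := by
  have h : ∑ j ∈ Finset.univ.filter (i < ·), a i j ≤ a i i := by
    rw [ha.diag i]
    refine Finset.sum_le_sum_of_subset fun j hj => ?_
    simp only [Finset.mem_filter, Finset.mem_univ, true_and] at hj
    simp [hj.ne']
  simp only [bLast, h0, hn, or_self, if_false]
  push_cast [Nat.cast_sub h]
  rfl

end Matrices

noncomputable section

open MvPolynomial

variable {n : ℕ} (k : Type*) [Field k] (a : Matrix (Fin n) (Fin n) ℕ)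

/-- The monomial `x^α = x₁^{α₁} ⋯ xₙ^{αₙ}` of `k[x₁, …, xₙ]`. -/
def monom (α : Fin n → ℕ) : MvPolynomial (Fin n) k := ∏ i, X i ^ α i

/-- The binomial defined by the `j`-th column:
`f_j = x_j^{a_{jj}} - ∏_{i ≠ j} x_i^{a_{ij}}`. -/
def binom (j : Fin n) : MvPolynomial (Fin n) k :=
  X j ^ a j j - ∏ i ∈ Finset.univ.erase j, X i ^ a i j

/-- The ideal `I = (f₁, …, fₙ)`. -/
def idealI : Ideal (MvPolynomial (Fin n) k) := Ideal.span (Set.range (binom k a))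

/-- The ideal `J = (f₁, …, fₙ₋₁)`. -/
def idealJ : Ideal (MvPolynomial (Fin n) k) := Ideal.span (binom k a '' {j | (j : ℕ) + 1 < n})

variable (n) in
/-- The Laurent polynomial ring `B = S⁻¹A`, the localization of `A = k[x₁, …, xₙ]` at the
powers of `x₁ ⋯ xₙ`. -/
abbrev LaurentRing : Type _ :=
  Localization.Away (∏ i : Fin n, (X i : MvPolynomial (Fin n) k))

variable {k}

/-- `S(I) = IB ∩ A`, the contraction to `A` of the extension of `I` to `B`. -/
def saturation (I : Ideal (MvPolynomial (Fin n) k)) : Ideal (MvPolynomial (Fin n) k) :=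
  (I.map (algebraMap (MvPolynomial (Fin n) k) (LaurentRing n k))).comap
    (algebraMap (MvPolynomial (Fin n) k) (LaurentRing n k))

end

section Hull

variable {R : Type*} [CommRing R]

/-- `q` is an isolated primary component of `I`: it occurs in a minimal primary decomposition of
`I`, and its radical is a minimal prime over `I`. -/
def IsIsolatedComponent (I q : Ideal R) : Prop :=
  (∃ t : Finset (Ideal R), Submodule.IsMinimalPrimaryDecomposition I t ∧ q ∈ t) ∧
    q.radical ∈ I.minimalPrimes

/-- `hull(I)`, the intersection of the isolated primary components of `I`. -/
def hull (I : Ideal R) : Ideal R := sInf {q | IsIsolatedComponent I q}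

end Hull

end PCB

namespace PCB

noncomputable section

open MvPolynomial

variable {n : ℕ} {k : Type*} [Field k] {a : Matrix (Fin n) (Fin n) ℕ}

/-! Read column `j` as firing vertex `j`: it loses `a j j` chips and each other vertex `i` gains `a
i j`. A legal firing of `j` moves a monomial by a multiple of `f_j`. Two exponents in the same coset
of the column lattice need not be joined by legal firings, but the extra chips `b(n)` make enough
firings legal (`monom_add_bLast_sub_mem`). Since the row sums of `L` vanish, the last vertex never
has to fire, so `J` suffices. In the group algebra of the cokernel of `L` the monomials are units,
so `S(I)` lies in the kernel of `toGroupAlgebra`; the firing argument puts that kernel in `J : x^b`.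
The chain `S(I) ≤ J : x^b ≤ I : x^b ≤ S(I)` then closes. For the hull, the isolated components are
those whose radical contains no variable. A positive left null vector of `L` gives a monomial curve
whose prime excludes variables from minimal primes (`X_notMem_of_mem_minimalPrimes`). Conversely,
`A/S(I)` is integral over each `k[x_j]`, whose nonzero elements are nonzerodivisors on it, so an
associated prime without variables is minimal (`mem_minimalPrimes_of_mem_associatedPrimes`). All
other components vanish on inverting the variables. -/

/-! ### Firing vectors. -/

/-- The linear map `c ↦ L c` of the critical binomial matrix `L`, written with the help of the
vanishing of the row sums of `L`. -/
def fire (a : Matrix (Fin n) (Fin n) ℕ) : (Fin n → ℤ) →ₗ[ℤ] (Fin n → ℤ) where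
  toFun c i := ∑ j, (a i j : ℤ) * (c i - c j)
  map_add' c d := by
    ext i
    simp only [Pi.add_apply, ← Finset.sum_add_distrib]
    exact Finset.sum_congr rfl fun j _ => by ring
  map_smul' r c := by
    ext i
    simp only [Pi.smul_apply, smul_eq_mul, RingHom.id_apply, Finset.mul_sum]
    exact Finset.sum_congr rfl fun j _ => by ring

theorem fire_apply (c : Fin n → ℤ) (i : Fin n) :
    fire a c i = ∑ j, (a i j : ℤ) * (c i - c j) := rfl

theorem fire_const (r : ℤ) : fire a (fun _ => r) = 0 := by
  ext i
  simp [fire_apply]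

/-- The indicator vector of a set of indices. -/
def ind (M : Finset (Fin n)) (i : Fin n) : ℤ := if i ∈ M then 1 else 0

theorem fire_ind_of_mem {M : Finset (Fin n)} {i : Fin n} (hi : i ∈ M) :
    fire a (ind M) i = ∑ j ∈ Mᶜ, (a i j : ℤ) := by
  rw [fire_apply, ← Finset.sum_subset (Finset.subset_univ Mᶜ)]
  · refine Finset.sum_congr rfl fun j hj => ?_
    simp [ind, hi, Finset.mem_compl.1 hj]
  · intro j _ hj
    simp [ind, hi, by simpa using hj]

theorem fire_ind_of_notMem {M : Finset (Fin n)} {i : Fin n} (hi : i ∉ M) :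
    fire a (ind M) i = -∑ j ∈ M, (a i j : ℤ) := by
  rw [fire_apply, ← Finset.sum_subset (Finset.subset_univ M), ← Finset.sum_neg_distrib]
  · refine Finset.sum_congr rfl fun j hj => ?_
    simp [ind, hi, hj]
  · intro j _ hj
    simp [ind, hi, hj]

theorem fire_single_self (ha : IsPCB a) (j : Fin n) : fire a (ind {j}) j = a j j := by
  rw [fire_ind_of_mem (by simp), ha.diag j]
  push_cast
  refine Finset.sum_congr ?_ fun _ _ => rfl
  ext; simp

theorem fire_single_of_ne {i j : Fin n} (h : i ≠ j) : fire a (ind {j}) i = -a i j := by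
  rw [fire_ind_of_notMem (by simpa using h)]
  simp

theorem ind_insert {j : Fin n} {M : Finset (Fin n)} (hj : j ∉ M) :
    ind (insert j M) = ind {j} + ind M := by
  ext i
  by_cases h : i = j
  · subst h; simp [ind, hj]
  · simp [ind, h]

/-! ### Monomials modulo `J` and legal firings. -/

theorem monom_add (u v : Fin n → ℕ) : monom k (u + v) = monom k u * monom k v := by
  simp [monom, pow_add, Finset.prod_mul_distrib]

theorem monom_single (j : Fin n) (r : ℕ) : monom k (Pi.single j r) = X j ^ r := by
  rw [monom, Finset.prod_eq_single j]
  · simp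
  · intro i _ h
    simp [h]
  · simp

/-- The binomial of the `j`-th column is the difference of two monomials. -/
theorem binom_eq (j : Fin n) :
    binom k a j = monom k (Pi.single j (a j j)) -
      monom k (fun i => if i = j then 0 else a i j) := by
  rw [binom, monom_single, monom, ← Finset.mul_prod_erase _ _ (Finset.mem_univ j)]
  congr 1
  simp only [if_true, pow_zero, one_mul]
  refine Finset.prod_congr rfl fun i hi => ?_
  rw [if_neg (Finset.ne_of_mem_erase hi)]

/-- A legal firing of a vertex different from the last one does not change the class of a monomial
modulo `J`. -/
theorem monom_sub_monom_mem_of_single (ha : IsPCB a) {u v : Fin n → ℕ} {j : Fin n}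
    (hj : (j : ℕ) + 1 < n) (hu : a j j ≤ u j)
    (h : ∀ i, (v i : ℤ) = u i - fire a (ind {j}) i) : monom k u - monom k v ∈ idealJ k a := by
  have h1 : u = (u - Pi.single j (a j j)) + Pi.single j (a j j) := by
    ext i
    by_cases hi : i = j
    · subst hi; simp [hu]
    · simp [hi]
  have h2 : v = (u - Pi.single j (a j j)) + fun i => if i = j then 0 else a i j := by
    ext i
    have := h i
    by_cases hi : i = j
    · subst hi
      rw [fire_single_self ha] at this
      simp; omega
    · rw [fire_single_of_ne hi] at this
      simp [hi]; omega
  rw [h1, monom_add, h2, monom_add, ← mul_sub, ← binom_eq]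
  exact Ideal.mul_mem_left _ _ (Ideal.subset_span ⟨j, hj, rfl⟩)

/-- The defining property of `b(n)`: a vertex holding its share of `b(n)` can fire once it has one
further chip for each edge to a larger vertex. At the first vertex all neighbours are larger, so no
extra chip is needed. -/
theorem diag_le_bLast_add (ha : IsPCB a) {i : Fin n} (hi : (i : ℕ) + 1 < n) :
    a i i ≤ bLast a i + ∑ j ∈ Finset.univ.filter (i < ·), a i j := by
  by_cases h0 : (i : ℕ) = 0
  · rw [ha.diag i]
    refine le_add_left (Finset.sum_le_sum_of_subset fun j hj => ?_)
    have : j ≠ i := Finset.ne_of_mem_erase hj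
    simp only [Finset.mem_filter, Finset.mem_univ, true_and, Fin.lt_def]
    have : (j : ℕ) ≠ i := fun h => this (Fin.ext h)
    omega
  · have := ha.cast_bLast i h0 hi.ne
    zify
    linarith

/-- Firing a set of vertices, in decreasing order, from a configuration `u + b(n)`. -/
theorem exists_monom_sub_monom_mem_of_ind (ha : IsPCB a) {M : Finset (Fin n)}
    (hM : ∀ i ∈ M, (i : ℕ) + 1 < n) {u : Fin n → ℕ}
    (hu : ∀ i ∈ M, ∑ j ∈ Mᶜ, a i j ≤ u i) (F : Finset (Fin n)) (hF : F ⊆ M)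
    (hup : ∀ i ∈ M, i ∉ F → ∀ j ∈ F, i < j) :
    ∃ v : Fin n → ℕ, (∀ i, (v i : ℤ) = (u + bLast a) i - fire a (ind F) i) ∧
      monom k (u + bLast a) - monom k v ∈ idealJ k a := by
  induction F using Finset.induction_on_min with
  | empty =>
    refine ⟨u + bLast a, fun i => ?_, by simp⟩
    rw [fire_ind_of_notMem (by simp)]
    simp
  | insert s F hs ih =>
    have hsF : s ∉ F := fun h => lt_irrefl _ (hs s h)
    have hsM : s ∈ M := hF (Finset.mem_insert_self _ _)
    obtain ⟨v, hv, hJ⟩ := ih (fun x hx => hF (Finset.mem_insert_of_mem hx)) (by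
      intro i hi hiF j hj
      by_cases his : i = s
      · exact his ▸ hs j hj
      · exact hup i hi (by simp [his, hiF]) j (Finset.mem_insert_of_mem hj))
    -- `F` has already fired, and every vertex larger than `s` is in `F` or outside `M`. Chips
    -- received from `F` and the bound `hu` together cover all edges to larger vertices.
    have hgt : Finset.univ.filter (s < ·) ⊆ Mᶜ ∪ F := by
      intro j hj
      simp only [Finset.mem_filter, Finset.mem_univ, true_and] at hj
      rw [Finset.mem_union, Finset.mem_compl]
      by_contra! hcon
      have := hup j hcon.1 (by simp [hj.ne', hcon.2]) s (Finset.mem_insert_self _ _)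
      exact lt_asymm hj this
    have hle : a s s ≤ v s := by
      have h1 := diag_le_bLast_add ha (hM s hsM)
      have h2 : ∑ j ∈ Finset.univ.filter (s < ·), a s j ≤ ∑ j ∈ Mᶜ, a s j + ∑ j ∈ F, a s j :=
        (Finset.sum_le_sum_of_subset hgt).trans
          ((Nat.le_add_right _ _).trans_eq (Finset.sum_union_inter))
      have h3 := hu s hsM
      have h4 := hv s
      rw [fire_ind_of_notMem hsF] at h4
      simp only [Pi.add_apply] at h4
      zify at *
      linarith
    have hnn : ∀ i, 0 ≤ (v i : ℤ) - fire a (ind {s}) i := by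
      intro i
      by_cases his : i = s
      · subst his
        rw [fire_single_self ha]
        omega
      · rw [fire_single_of_ne his]
        omega
    have hw : ∀ i, (((v i : ℤ) - fire a (ind {s}) i).toNat : ℤ) = v i - fire a (ind {s}) i :=
      fun i => Int.toNat_of_nonneg (hnn i)
    refine ⟨fun i => ((v i : ℤ) - fire a (ind {s}) i).toNat, fun i => ?_, ?_⟩
    · rw [hw, hv, ind_insert hsF, map_add, Pi.add_apply (fire a (ind {s}))]
      ring
    · rw [← sub_add_sub_cancel _ (monom k v)]
      exact add_mem hJ (monom_sub_monom_mem_of_single ha (hM s hsM) hle hw)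

/-- Two monomials whose exponents are congruent modulo the columns of `L` other than the last one
become congruent modulo `J` after multiplication by `x^{b(n)}`. -/
theorem monom_add_bLast_sub_mem (ha : IsPCB a) (N : ℕ) (u v : Fin n → ℕ) (c : Fin n → ℤ)
    (hN : ∑ i, (c i).natAbs = N) (hc : ∀ i : Fin n, (i : ℕ) + 1 = n → c i = 0)
    (h : ∀ i, (u i : ℤ) - v i = fire a c i) :
    monom k (u + bLast a) - monom k (v + bLast a) ∈ idealJ k a := by
  induction N using Nat.strong_induction_on generalizing u v c with
  | _ N ih =>
  have key : ∀ (u v : Fin n → ℕ) (c : Fin n → ℤ), ∑ i, (c i).natAbs = N →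
      (∀ i : Fin n, (i : ℕ) + 1 = n → c i = 0) → (∀ i, (u i : ℤ) - v i = fire a c i) →
      (∃ i, 0 < c i) → monom k (u + bLast a) - monom k (v + bLast a) ∈ idealJ k a := by
    intro u v c hN hc h ⟨i₀, hi₀⟩
    obtain ⟨p, -, hp⟩ := Finset.exists_max_image Finset.univ c ⟨i₀, Finset.mem_univ _⟩
    have hp0 : 0 < c p := hi₀.trans_le (hp i₀ (Finset.mem_univ _))
    -- Fire the set where `c` is maximal. It omits the last vertex, where `c` vanishes, because the
    -- maximum is positive.
    set M : Finset (Fin n) := Finset.univ.filter (fun i => c i = c p) with hMdef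
    have hmem : ∀ i, i ∈ M ↔ c i = c p := by simp [hMdef]
    have hM : ∀ i ∈ M, (i : ℕ) + 1 < n := by
      intro i hi
      have := i.2
      refine lt_of_le_of_ne (by omega) fun hin => ?_
      have h1 := hc i hin
      have h2 := (hmem i).1 hi
      omega
    have hu : ∀ i ∈ M, ∑ j ∈ Mᶜ, a i j ≤ u i := by
      intro i hi
      -- By integrality `c` drops by at least 1 from `M` to its complement, so `c` demands at least
      -- as many chips of `i` as firing `M` does.
      have h1 : ∑ j ∈ Mᶜ, (a i j : ℤ) ≤ fire a c i := by
        rw [← fire_ind_of_mem hi, fire_apply, fire_apply]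
        refine Finset.sum_le_sum fun j _ => mul_le_mul_of_nonneg_left ?_ (by positivity)
        have hci := (hmem i).1 hi
        have hcj := hp j (Finset.mem_univ _)
        by_cases hj : j ∈ M
        · simp only [ind, hi, hj, if_true]; omega
        · have : c j ≠ c p := fun h => hj ((hmem j).2 h)
          simp only [ind, hi, hj, if_true, if_false]; omega
      have h2 := h i
      zify
      linarith [Int.natCast_nonneg (v i)]
    obtain ⟨w, hw, hJ⟩ := exists_monom_sub_monom_mem_of_ind (k := k) ha hM hu M subset_rfl
      (fun i hi hi' => absurd hi hi')
    have hnn : ∀ i, 0 ≤ (u i : ℤ) - fire a (ind M) i := by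
      intro i
      by_cases hi : i ∈ M
      · rw [fire_ind_of_mem hi]
        have := hu i hi
        zify at this
        linarith
      · rw [fire_ind_of_notMem hi, sub_neg_eq_add]
        exact add_nonneg (Int.natCast_nonneg _) (Finset.sum_nonneg fun _ _ => Int.natCast_nonneg _)
    have hu' : ∀ i, (((u i : ℤ) - fire a (ind M) i).toNat : ℤ) = u i - fire a (ind M) i :=
      fun i => Int.toNat_of_nonneg (hnn i)
    have hwu : w = (fun i => ((u i : ℤ) - fire a (ind M) i).toNat) + bLast a := by
      ext i
      zify
      rw [hw, Pi.add_apply, Pi.add_apply, Nat.cast_add, Nat.cast_add, hu']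
      ring
    rw [← sub_add_sub_cancel _ (monom k w)]
    refine add_mem hJ ?_
    rw [hwu]
    refine ih (∑ i, ((c - ind M) i).natAbs) ?_ _ v (c - ind M) rfl ?_ ?_
    · rw [← hN]
      refine Finset.sum_lt_sum (fun i _ => ?_) ⟨p, Finset.mem_univ _, ?_⟩
      · by_cases hi : i ∈ M
        · have := (hmem i).1 hi
          simp only [Pi.sub_apply, ind, hi, if_true]; omega
        · simp [ind, hi]
      · simp only [Pi.sub_apply, ind, (hmem p).2 rfl, if_true]; omega
    · intro i hi
      have : i ∉ M := fun hiM => (hM i hiM).ne hi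
      simp [ind, this, hc i hi]
    · intro i
      rw [hu', map_sub, Pi.sub_apply, ← h i]
      ring
  by_cases hpos : ∃ i, 0 < c i
  · exact key u v c hN hc h hpos
  by_cases hneg : ∃ i, c i < 0
  -- With no positive entry, exchange `u` and `v`, which replaces `c` by `-c`.
  · rw [← neg_mem_iff, neg_sub]
    refine key v u (-c) (by simpa using hN) (fun i hi => by simp [hc i hi]) (fun i => ?_)
      (by simpa using hneg)
    rw [map_neg, Pi.neg_apply, ← h i]
    ring
  · have hc0 : c = 0 := by
      ext i
      have h1 := not_exists.1 hpos i
      have h2 := not_exists.1 hneg i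
      simp only [Pi.zero_apply]
      omega
    have : u = v := by
      ext i
      have := h i
      rw [hc0, map_zero, Pi.zero_apply] at this
      omega
    rw [this, sub_self]
    exact zero_mem _

theorem monom_add_bLast_sub_mem_of_range (ha : IsPCB a) (hn : 0 < n) {u v : Fin n → ℕ}
    (h : (fun i => (u i : ℤ) - v i) ∈ LinearMap.range (fire a)) :
    monom k (u + bLast a) - monom k (v + bLast a) ∈ idealJ k a := by
  obtain ⟨c, hc⟩ := h
  let l : Fin n := ⟨n - 1, by omega⟩
  refine monom_add_bLast_sub_mem ha _ u v (c - fun _ => c l) rfl (fun i hi => ?_) (fun i => ?_)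
  · have : i = l := Fin.ext (by simp only [l]; omega)
    simp [this]
  · rw [map_sub, fire_const, sub_zero, hc]

/-! ### The group algebra of the cokernel. -/

/-- The cokernel of the critical binomial matrix. -/
abbrev Coker (a : Matrix (Fin n) (Fin n) ℕ) : Type := (Fin n → ℤ) ⧸ LinearMap.range (fire a)

/-- The class of an exponent vector in the cokernel. -/
def expClass (a : Matrix (Fin n) (Fin n) ℕ) (u : Fin n → ℕ) : Coker a :=
  Submodule.Quotient.mk fun i => (u i : ℤ)

theorem expClass_eq_iff {u v : Fin n → ℕ} : expClass a u = expClass a v ↔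
    (fun i => (u i : ℤ) - v i) ∈ LinearMap.range (fire a) := by
  rw [expClass, expClass, Submodule.Quotient.eq]
  rfl

theorem expClass_add (u v : Fin n → ℕ) :
    expClass a (u + v) = expClass a u + expClass a v := by
  rw [expClass, expClass, expClass, ← Submodule.Quotient.mk_add]
  exact congrArg _ (funext fun i => Nat.cast_add _ _)

theorem expClass_zero : expClass a 0 = 0 := by
  simp only [expClass, Pi.zero_apply, Nat.cast_zero]
  rfl

/-- `expClass` as a homomorphism. -/
def expClassHom (a : Matrix (Fin n) (Fin n) ℕ) : (Fin n → ℕ) →+ Coker a where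
  toFun := expClass a
  map_zero' := expClass_zero
  map_add' := expClass_add

variable (k a) in
/-- The homomorphism from the polynomial ring to the group algebra of the cokernel. -/
def toGroupAlgebra : MvPolynomial (Fin n) k →ₐ[k] AddMonoidAlgebra k (Coker a) :=
  aeval fun i => AddMonoidAlgebra.single (expClass a (Pi.single i 1)) 1

theorem toGroupAlgebra_X_pow (i : Fin n) (r : ℕ) : toGroupAlgebra k a (X i ^ r) =
    AddMonoidAlgebra.single (expClass a (Pi.single i r)) 1 := by
  rw [map_pow, toGroupAlgebra, aeval_X, AddMonoidAlgebra.single_pow, one_pow]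
  congr 1
  change r • expClassHom a (Pi.single i 1) = expClassHom a (Pi.single i r)
  rw [← map_nsmul, ← Pi.single_smul]
  simp

theorem toGroupAlgebra_monom (u : Fin n → ℕ) :
    toGroupAlgebra k a (monom k u) = AddMonoidAlgebra.single (expClass a u) 1 := by
  have h : ∀ s : Finset (Fin n), toGroupAlgebra k a (∏ i ∈ s, X i ^ u i) =
      AddMonoidAlgebra.single (expClassHom a (∑ i ∈ s, Pi.single i (u i))) 1 := by
    intro s
    induction s using Finset.induction_on with
    | empty =>
      rw [Finset.prod_empty, map_one, Finset.sum_empty, map_zero, AddMonoidAlgebra.one_def]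
    | insert i s hi ih =>
      rw [Finset.prod_insert hi, map_mul, ih, toGroupAlgebra_X_pow, Finset.sum_insert hi,
        AddMonoidAlgebra.single_mul_single, map_add, mul_one]
      rfl
  rw [monom, h, Finset.univ_sum_single]
  rfl

theorem monomial_eq_smul_monom (u : Fin n →₀ ℕ) (r : k) :
    monomial u r = r • monom k (u : Fin n → ℕ) := by
  rw [monomial_eq, smul_eq_C_mul, monom, Finsupp.prod_fintype _ _ (fun _ => pow_zero _)]

theorem toGroupAlgebra_binom (ha : IsPCB a) (j : Fin n) :
    toGroupAlgebra k a (binom k a j) = 0 := by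
  rw [binom_eq, map_sub, toGroupAlgebra_monom, toGroupAlgebra_monom, sub_eq_zero]
  congr 1
  rw [expClass_eq_iff]
  refine ⟨ind {j}, ?_⟩
  ext i
  by_cases h : i = j
  · subst h; simp [fire_single_self ha]
  · simp [fire_single_of_ne h, h]

/-! ### The saturation as a kernel and as a colon ideal. -/

theorem mem_saturation_iff {I : Ideal (MvPolynomial (Fin n) k)} {f : MvPolynomial (Fin n) k} :
    f ∈ saturation I ↔ ∃ N : ℕ, (∏ i, X i) ^ N * f ∈ I := by
  rw [saturation, Ideal.mem_comap,
    IsLocalization.mem_map_algebraMap_iff (Submonoid.powers (∏ i : Fin n, X i))]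
  have hinj : Function.Injective (algebraMap (MvPolynomial (Fin n) k) (LaurentRing n k)) := by
    refine IsLocalization.injective _ (M := Submonoid.powers (∏ i : Fin n, X i)) ?_
    rw [Submonoid.powers_le]
    exact mem_nonZeroDivisors_of_ne_zero (Finset.prod_ne_zero_iff.2 fun i _ => X_ne_zero i)
  constructor
  · rintro ⟨⟨⟨g, hg⟩, ⟨_, N, rfl⟩⟩, h⟩
    rw [← map_mul] at h
    refine ⟨N, ?_⟩
    rw [mul_comm, hinj h]
    exact hg
  · rintro ⟨N, hN⟩
    exact ⟨⟨⟨_, hN⟩, ⟨_, N, rfl⟩⟩, by rw [← map_mul, mul_comm]⟩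

theorem toGroupAlgebra_eq_zero_of_mem (ha : IsPCB a) {f : MvPolynomial (Fin n) k}
    (hf : f ∈ saturation (idealI k a)) : toGroupAlgebra k a f = 0 := by
  obtain ⟨N, hN⟩ := mem_saturation_iff.1 hf
  have hI : idealI k a ≤ RingHom.ker (toGroupAlgebra k a) := by
    rw [idealI, Ideal.span_le]
    rintro _ ⟨j, rfl⟩
    exact toGroupAlgebra_binom ha j
  have h0 : toGroupAlgebra k a ((∏ i, X i) ^ N * f) = 0 := hI hN
  have hu : IsUnit (toGroupAlgebra k a ((∏ i, X i) ^ N)) := by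
    rw [map_pow]
    refine IsUnit.pow _ ?_
    have : (∏ i : Fin n, X i : MvPolynomial (Fin n) k) = monom k 1 := by simp [monom]
    rw [this, toGroupAlgebra_monom]
    refine IsUnit.of_mul_eq_one (AddMonoidAlgebra.single (-expClass a 1) 1) ?_
    rw [AddMonoidAlgebra.single_mul_single, add_neg_cancel, mul_one, AddMonoidAlgebra.one_def]
  rw [map_mul] at h0
  exact (hu.mul_right_eq_zero).1 h0

/-- Modulo `J : x^b` a monomial depends only on its class in the cokernel, so the quotient map
factors through `toGroupAlgebra`; the factor `s` is built from arbitrary representatives `r`. -/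
theorem mem_colon_of_toGroupAlgebra_eq_zero (ha : IsPCB a) (hn : 0 < n)
    {f : MvPolynomial (Fin n) k} (hf : toGroupAlgebra k a f = 0) :
    f ∈ (idealJ k a).colon {monom k (bLast a)} := by
  classical
  set C := (idealJ k a).colon {monom k (bLast a)} with hC
  let r : Coker a → Fin n → ℕ := Function.invFun (expClass a)
  have hr : ∀ u, expClass a (r (expClass a u)) = expClass a u := fun u =>
    Function.invFun_eq ⟨u, rfl⟩
  let s : (Coker a →₀ k) →ₗ[k] MvPolynomial (Fin n) k ⧸ C :=
    Finsupp.linearCombination k fun g => Ideal.Quotient.mk C (monom k (r g))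
  have key : ∀ p : MvPolynomial (Fin n) k,
      s (toGroupAlgebra k a p).coeff = Ideal.Quotient.mk C p := by
    intro p
    induction p using MvPolynomial.induction_on' with
    | monomial u c =>
      rw [monomial_eq_smul_monom, map_smul, toGroupAlgebra_monom, AddMonoidAlgebra.coeff_smul,
        map_smul, AddMonoidAlgebra.coeff_single, Finsupp.linearCombination_single, one_smul]
      have h : Ideal.Quotient.mk C (monom k (r (expClass a u))) =
          Ideal.Quotient.mk C (monom k (u : Fin n → ℕ)) := by
        rw [Ideal.Quotient.eq, hC, Submodule.mem_colon_singleton, smul_eq_mul, sub_mul,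
          ← monom_add, ← monom_add]
        exact monom_add_bLast_sub_mem_of_range ha hn (expClass_eq_iff.1 (hr u))
      rw [h]
      rfl
    | add p q hp hq => rw [map_add, AddMonoidAlgebra.coeff_add, map_add, hp, hq, map_add]
  rw [← Ideal.Quotient.eq_zero_iff_mem, ← key, hf, AddMonoidAlgebra.coeff_zero, map_zero]

theorem idealJ_le_idealI : idealJ k a ≤ idealI k a :=
  Ideal.span_mono (Set.image_subset_range _ _)

theorem colon_idealI_le_saturation :
    (idealI k a).colon {monom k (bLast a)} ≤ saturation (idealI k a) := by
  intro f hf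
  rw [Submodule.mem_colon_singleton, smul_eq_mul] at hf
  rw [mem_saturation_iff]
  refine ⟨∑ i, bLast a i, ?_⟩
  have hdvd : monom k (bLast a) ∣ (∏ i, X i : MvPolynomial (Fin n) k) ^ (∑ i, bLast a i) := by
    rw [monom, ← Finset.prod_pow]
    exact Finset.prod_dvd_prod_of_dvd _ _ fun i _ => pow_dvd_pow (X i : MvPolynomial (Fin n) k)
      (Finset.single_le_sum (f := bLast a) (fun _ _ => Nat.zero_le _) (Finset.mem_univ i))
  obtain ⟨g, hg⟩ := hdvd
  rw [hg, mul_right_comm, mul_comm (monom k _)]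
  exact Ideal.mul_mem_right _ _ hf

theorem saturation_eq_colon_idealJ (ha : IsPCB a) (hn : 0 < n) :
    saturation (idealI k a) = (idealJ k a).colon {monom k (bLast a)} :=
  le_antisymm (fun _ hf => mem_colon_of_toGroupAlgebra_eq_zero ha hn
    (toGroupAlgebra_eq_zero_of_mem ha hf))
    ((Submodule.colon_mono (idealJ_le_idealI (k := k)) subset_rfl).trans colon_idealI_le_saturation)

theorem saturation_eq_colon_idealI (ha : IsPCB a) (hn : 0 < n) :
    saturation (idealI k a) = (idealI k a).colon {monom k (bLast a)} :=
  le_antisymm ((saturation_eq_colon_idealJ ha hn).trans_le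
    (Submodule.colon_mono (idealJ_le_idealI (k := k)) subset_rfl)) colon_idealI_le_saturation

theorem mem_saturation_iff_toGroupAlgebra (ha : IsPCB a) (hn : 0 < n)
    {f : MvPolynomial (Fin n) k} :
    f ∈ saturation (idealI k a) ↔ toGroupAlgebra k a f = 0 :=
  ⟨toGroupAlgebra_eq_zero_of_mem ha, fun h =>
    (saturation_eq_colon_idealJ ha hn).ge (mem_colon_of_toGroupAlgebra_eq_zero ha hn h)⟩

/-! ### Positive weights and the grading. -/

theorem sum_row (ha : IsPCB a) (i : Fin n) : ∑ j, (a i j : ℤ) = 2 * a i i := by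
  rw [← Finset.add_sum_erase _ _ (Finset.mem_univ i), ← Nat.cast_sum, ← ha.diag i]
  ring

/-- A critical binomial matrix is annihilated from the left by a vector of positive integers. -/
theorem exists_pos_weight (ha : IsPCB a) (hn : 0 < n) :
    ∃ m : Fin n → ℕ, (∀ i, 0 < m i) ∧ ∀ j, m j * a j j = ∑ i ∈ Finset.univ.erase j, m i * a i j := by
  have hdet : (LinearMap.toMatrix' (fire a)).det = 0 := by
    rw [← Matrix.exists_mulVec_eq_zero_iff]
    refine ⟨fun _ => 1, fun h => one_ne_zero (congrFun h ⟨0, hn⟩), ?_⟩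
    rw [LinearMap.toMatrix'_mulVec, fire_const]
  obtain ⟨v, hv0, hv⟩ := Matrix.exists_vecMul_eq_zero_iff.2 hdet
  have hcol : ∀ j, v j * a j j = ∑ i ∈ Finset.univ.erase j, v i * a i j := by
    intro j
    have h : v ⬝ᵥ fire a (ind {j}) = 0 := by
      rw [← LinearMap.toMatrix'_mulVec, Matrix.dotProduct_mulVec, hv, zero_dotProduct]
    rw [dotProduct, ← Finset.add_sum_erase _ _ (Finset.mem_univ j), fire_single_self ha,
      Finset.sum_congr rfl fun i hi => by
        rw [fire_single_of_ne (Finset.ne_of_mem_erase hi), mul_neg],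
      Finset.sum_neg_distrib] at h
    linarith
  have hle : ∀ j, |v j| * a j j ≤ ∑ i ∈ Finset.univ.erase j, |v i| * a i j := by
    intro j
    calc |v j| * a j j = |v j * a j j| := by rw [abs_mul, Nat.abs_cast]
      _ ≤ ∑ i ∈ Finset.univ.erase j, |v i * a i j| := by
        rw [hcol j]; exact Finset.abs_sum_le_sum_abs _ _
      _ = _ := Finset.sum_congr rfl fun i _ => by rw [abs_mul, Nat.abs_cast]
  -- The zero row sums force equality in the sum of the inequalities `hle`, hence in each one. So
  -- absolute values of a left null vector again form a left null vector, and one zero entry would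
  -- make all entries zero.
  have hsum : ∑ j, |v j| * (a j j : ℤ) = ∑ j, ∑ i ∈ Finset.univ.erase j, |v i| * (a i j : ℤ) := by
    have h1 : ∀ j, ∑ i ∈ Finset.univ.erase j, |v i| * (a i j : ℤ) =
        ∑ i, |v i| * (a i j : ℤ) - |v j| * a j j := fun j => by
      rw [← Finset.add_sum_erase _ _ (Finset.mem_univ j)]; ring
    simp only [h1, Finset.sum_sub_distrib]
    rw [Finset.sum_comm]
    simp only [← Finset.mul_sum, sum_row ha]
    rw [← Finset.sum_sub_distrib]
    exact Finset.sum_congr rfl fun j _ => by ring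
  have heq : ∀ j, |v j| * (a j j : ℤ) = ∑ i ∈ Finset.univ.erase j, |v i| * (a i j : ℤ) :=
    fun j => (Finset.sum_eq_sum_iff_of_le fun j _ => hle j).1 hsum j (Finset.mem_univ j)
  refine ⟨fun i => (v i).natAbs, fun j => ?_, fun j => ?_⟩
  · rw [Int.natAbs_pos]
    intro hj
    apply hv0
    have h0 := heq j
    rw [hj, abs_zero, zero_mul, eq_comm, Finset.sum_eq_zero_iff_of_nonneg
      (fun i _ => by positivity)] at h0
    ext i
    by_cases hij : i = j
    · rw [hij, hj]; rfl
    · have := h0 i (by simp [hij])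
      have hpos := ha.pos i j
      rcases mul_eq_zero.1 this with h | h
      · exact abs_eq_zero.1 h
      · omega
  · zify
    exact heq j

theorem sum_weight_mul_fire (ha : IsPCB a) {m : Fin n → ℕ}
    (hm : ∀ j, m j * a j j = ∑ i ∈ Finset.univ.erase j, m i * a i j) (c : Fin n → ℤ) :
    ∑ i, (m i : ℤ) * fire a c i = 0 := by
  have hcol : ∀ j, ∑ i, (m i : ℤ) * a i j = 2 * (m j * a j j) := by
    intro j
    have := hm j
    zify at this
    rw [← Finset.add_sum_erase _ _ (Finset.mem_univ j), ← this]
    ring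
  have h : ∀ i, (m i : ℤ) * fire a c i =
      2 * (m i * a i i) * c i - ∑ j, (m i : ℤ) * a i j * c j := by
    intro i
    rw [fire_apply, Finset.sum_congr rfl fun j _ => mul_sub _ _ _, Finset.sum_sub_distrib,
      ← Finset.sum_mul, sum_row ha, mul_sub, Finset.mul_sum]
    congr 1
    · ring
    · exact Finset.sum_congr rfl fun j _ => by ring
  rw [Finset.sum_congr rfl fun i _ => h i, Finset.sum_sub_distrib, Finset.sum_comm, sub_eq_zero]
  exact Finset.sum_congr rfl fun j _ => by rw [← Finset.sum_mul, hcol]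

/-- Maximum principle: at a maximum of `c` all summands are nonnegative with positive coefficients.
-/
theorem eq_of_fire_eq_zero (ha : IsPCB a) {c : Fin n → ℤ} (hc : fire a c = 0) (i j : Fin n) :
    c i = c j := by
  obtain ⟨p, -, hp⟩ := Finset.exists_max_image Finset.univ c ⟨i, Finset.mem_univ _⟩
  have h := congrFun hc p
  rw [fire_apply, Pi.zero_apply, Finset.sum_eq_zero_iff_of_nonneg fun j _ =>
    mul_nonneg (Int.natCast_nonneg _) (sub_nonneg.2 (hp j (Finset.mem_univ j)))] at h
  have key : ∀ j, c j = c p := fun j => by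
    have hpos := ha.pos p j
    rcases mul_eq_zero.1 (h j (Finset.mem_univ j)) with h | h <;> omega
  rw [key i, key j]

/-- Any two variables are related, in the cokernel of a critical binomial matrix, by positive
multiples. -/
theorem exists_expClass_single_eq (ha : IsPCB a) (hn : 0 < n) (i j : Fin n) :
    ∃ d e : ℕ, 0 < d ∧ 0 < e ∧ expClass a (Pi.single i d) = expClass a (Pi.single j e) := by
  obtain ⟨m, hm0, hm⟩ := exists_pos_weight ha hn
  -- Adding a diagonal unit at `j` makes the matrix nonsingular. Its adjugate then solves `fire a w
  -- + w j • e_j = D • e_i`, and pairing with the weights `m` shows that `w j` and `D` have the same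
  -- sign.
  let g : (Fin n → ℤ) →ₗ[ℤ] (Fin n → ℤ) :=
    fire a + (LinearMap.single ℤ (fun _ => ℤ) j).comp (LinearMap.proj j)
  have hg : ∀ c, g c = fire a c + Pi.single j (c j) := fun c => rfl
  have hweight : ∀ l (r : ℤ), ∑ i, (m i : ℤ) * (Pi.single l r : Fin n → ℤ) i = m l * r := by
    intro l r
    rw [Finset.sum_eq_single l]
    · simp
    · intro b _ hb
      simp [hb]
    · simp
  have hdet : (LinearMap.toMatrix' g).det ≠ 0 := by
    rw [Ne, ← Matrix.exists_mulVec_eq_zero_iff]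
    rintro ⟨c, hc0, hc⟩
    rw [LinearMap.toMatrix'_mulVec, hg] at hc
    have h1 : (m j : ℤ) * c j = 0 := by
      have : ∑ i, (m i : ℤ) * (fire a c + Pi.single j (c j) : Fin n → ℤ) i = 0 := by rw [hc]; simp
      simpa only [Pi.add_apply, mul_add, Finset.sum_add_distrib, sum_weight_mul_fire ha hm,
        zero_add, hweight] using this
    have h2 : c j = 0 := (mul_eq_zero.1 h1).resolve_left (by exact_mod_cast (hm0 j).ne')
    rw [h2, Pi.single_zero, add_zero] at hc
    exact hc0 (funext fun l => (eq_of_fire_eq_zero ha hc l j).trans h2)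
  obtain ⟨D, w, hD, hw⟩ : ∃ (D : ℤ) (w : Fin n → ℤ), 0 < D ∧ g w = Pi.single i D := by
    have h : g ((LinearMap.toMatrix' g).adjugate.mulVec (Pi.single i 1)) =
        Pi.single i (LinearMap.toMatrix' g).det := by
      rw [← LinearMap.toMatrix'_mulVec, Matrix.mulVec_mulVec, Matrix.mul_adjugate,
        Matrix.smul_mulVec, Matrix.one_mulVec, ← Pi.single_smul, smul_eq_mul, mul_one]
    rcases lt_or_gt_of_ne hdet with hneg | hpos
    · exact ⟨_, -_, neg_pos.2 hneg, by rw [map_neg, h, Pi.single_neg]⟩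
    · exact ⟨_, _, hpos, h⟩
  rw [hg] at hw
  have hwj : 0 < w j := by
    have h1 : (m j : ℤ) * w j = m i * D := by
      have : ∑ l, (m l : ℤ) * (fire a w + Pi.single j (w j) : Fin n → ℤ) l = m i * D := by rw [hw, hweight]
      simpa only [Pi.add_apply, mul_add, Finset.sum_add_distrib, sum_weight_mul_fire ha hm,
        zero_add, hweight] using this
    have h2 : (0 : ℤ) < m j * w j := by
      rw [h1]; exact mul_pos (by exact_mod_cast hm0 i) hD
    exact pos_of_mul_pos_right h2 (by positivity)
  refine ⟨D.toNat, (w j).toNat, by omega, by omega, ?_⟩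
  rw [expClass_eq_iff]
  refine ⟨w, ?_⟩
  rw [eq_sub_of_add_eq hw]
  have hcast : ∀ (l x : Fin n) (r : ℤ), 0 < r →
      (((Pi.single l r.toNat : Fin n → ℕ) x : ℕ) : ℤ) = (Pi.single l r : Fin n → ℤ) x := by
    intro l x r hr
    by_cases hx : x = l
    · subst hx; simp [hr.le]
    · simp [hx]
  ext x
  rw [hcast i x D hD, hcast j x (w j) hwj, Pi.sub_apply]

/-- The positive grading of the cokernel. -/
theorem exists_degree (ha : IsPCB a) (hn : 0 < n) :
    ∃ deg : Coker a →+ ℤ, ∀ i, 0 < deg (expClass a (Pi.single i 1)) := by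
  obtain ⟨m, hm0, hm⟩ := exists_pos_weight ha hn
  let l : (Fin n → ℤ) →ₗ[ℤ] ℤ := ∑ i, (m i : ℤ) • LinearMap.proj i
  have hl : ∀ c, l c = ∑ i, (m i : ℤ) * c i := fun c => by
    simp [l, LinearMap.sum_apply]
  have hle : LinearMap.range (fire a) ≤ LinearMap.ker l := by
    rintro _ ⟨c, rfl⟩
    rw [LinearMap.mem_ker, hl, sum_weight_mul_fire ha hm]
  refine ⟨((LinearMap.range (fire a)).liftQ l hle).toAddMonoidHom, fun i => ?_⟩
  change 0 < l fun j => ((Pi.single i 1 : Fin n → ℕ) j : ℤ)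
  rw [hl, Finset.sum_eq_single i]
  · simpa using hm0 i
  · intro b _ hb
    simp [hb]
  · simp

/-- In a group algebra, a nonzero polynomial in an element of positive degree of the group is not
a zero divisor. -/
theorem eq_zero_of_aeval_single_mul_eq_zero {G : Type*} [AddCommGroup G] (deg : G →+ ℤ) {e : G}
    (he : 0 < deg e) {h : Polynomial k} (hh : h ≠ 0) {g : AddMonoidAlgebra k G}
    (hg : Polynomial.aeval (AddMonoidAlgebra.single e (1 : k)) h * g = 0) : g = 0 := by
  classical
  by_contra hg0
  have hinj : Function.Injective fun d : ℕ => d • e := by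
    intro d d' hd
    have := congrArg deg hd
    simp only [map_nsmul, nsmul_eq_mul] at this
    exact_mod_cast mul_right_cancel₀ he.ne' this
  set F := Polynomial.aeval (AddMonoidAlgebra.single e (1 : k)) h with hF
  have hFc : F.coeff = ∑ d ∈ Finset.range (h.natDegree + 1),
      Finsupp.single (d • e) (h.coeff d) := by
    rw [hF, Polynomial.aeval_eq_sum_range, AddMonoidAlgebra.coeff_sum]
    refine Finset.sum_congr rfl fun d _ => ?_
    rw [AddMonoidAlgebra.single_pow, one_pow, AddMonoidAlgebra.coeff_smul,
      AddMonoidAlgebra.coeff_single, Finsupp.smul_single, smul_eq_mul, mul_one]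
  have hsupp : ∀ x ∈ F.coeff.support, ∃ d ≤ h.natDegree, x = d • e := by
    intro x hx
    rw [hFc] at hx
    obtain ⟨d, hd, hx⟩ := Finset.mem_biUnion.1 (Finsupp.support_finsetSum hx)
    exact ⟨d, Nat.lt_succ_iff.1 (Finset.mem_range.1 hd),
      Finset.mem_singleton.1 (Finsupp.support_single_subset hx)⟩
  have htop : F.coeff (h.natDegree • e) = h.leadingCoeff := by
    rw [hFc, Finsupp.finsetSum_apply, Finset.sum_eq_single h.natDegree]
    · simp
    · intro d _ hd
      exact Finsupp.single_eq_of_ne fun h' => hd (hinj h'.symm)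
    · simp
  have hne : g.coeff.support.Nonempty := by
    rw [Finsupp.support_nonempty_iff]
    simpa using hg0
  obtain ⟨y, hy, hymax⟩ := Finset.exists_max_image g.coeff.support deg hne
  -- The top power of `e` and a support element `y` of maximal degree give a term of the product
  -- that nothing else can cancel.
  have huniq : UniqueAdd F.coeff.support g.coeff.support (h.natDegree • e) y := by
    intro x z hx hz hxz
    obtain ⟨d, hd, rfl⟩ := hsupp x hx
    have h1 := congrArg deg hxz
    have h2 := hymax z hz
    simp only [map_add, map_nsmul, nsmul_eq_mul] at h1
    have h3 : (h.natDegree : ℤ) * deg e ≤ d * deg e := by linarith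
    have h4 : h.natDegree = d := le_antisymm (by exact_mod_cast le_of_mul_le_mul_right h3 he) hd
    subst h4
    exact ⟨rfl, add_left_cancel hxz⟩
  have := AddMonoidAlgebra.coeff_mul_add_of_uniqueAdd huniq
  rw [hg, htop] at this
  exact mul_ne_zero (Polynomial.leadingCoeff_ne_zero.2 hh) (Finsupp.mem_support_iff.1 hy)
    this.symm

/-! ### Minimal primes, associated primes and the hull. -/

theorem X_mem_of_X_mem (ha : IsPCB a) {p : Ideal (MvPolynomial (Fin n) k)} [hp : p.IsPrime]
    (hI : idealI k a ≤ p) {i : Fin n} (hi : X i ∈ p) (j : Fin n) : X j ∈ p := by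
  by_cases hij : i = j
  · exact hij ▸ hi
  have h1 : binom k a j ∈ p := hI (Ideal.subset_span ⟨j, rfl⟩)
  have h2 : ∏ l ∈ Finset.univ.erase j, (X l : MvPolynomial (Fin n) k) ^ a l j ∈ p :=
    Ideal.mem_of_dvd _ ((dvd_pow_self _ (ha.pos i j).ne').trans
      (Finset.dvd_prod_of_mem (fun l => (X l : MvPolynomial (Fin n) k) ^ a l j)
        (Finset.mem_erase.2 ⟨hij, Finset.mem_univ i⟩))) hi
  refine hp.mem_of_pow_mem (a j j) ?_
  have := add_mem h1 h2
  rwa [binom, sub_add_cancel] at this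

theorem aeval_zero_eq_zero_of_mem_ker {m : Fin n → ℕ} (hm : ∀ i, 0 < m i)
    {f : MvPolynomial (Fin n) k}
    (hf : aeval (fun i => (Polynomial.X : Polynomial k) ^ m i) f = 0) :
    constantCoeff f = 0 := by
  have h : ((Polynomial.aeval (0 : k)).comp
      (aeval fun i => (Polynomial.X : Polynomial k) ^ m i)) = aeval (0 : Fin n → k) := by
    refine MvPolynomial.algHom_ext fun i => ?_
    simp [(hm i).ne']
  have h1 := DFunLike.congr_fun h f
  rw [AlgHom.comp_apply, hf, map_zero, aeval_zero] at h1
  exact h1.symm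

theorem mem_of_constantCoeff_eq_zero {p : Ideal (MvPolynomial (Fin n) k)} (hp : ∀ i, X i ∈ p)
    {f : MvPolynomial (Fin n) k} (hf : constantCoeff f = 0) : f ∈ p := by
  have h : Ideal.Quotient.mkₐ k p = aeval (0 : Fin n → MvPolynomial (Fin n) k ⧸ p) := by
    refine MvPolynomial.algHom_ext fun i => ?_
    rw [aeval_X, Ideal.Quotient.mkₐ_eq_mk]
    exact Ideal.Quotient.eq_zero_iff_mem.2 (hp i)
  have h1 := DFunLike.congr_fun h f
  rw [Ideal.Quotient.mkₐ_eq_mk, aeval_zero, hf, map_zero] at h1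
  exact Ideal.Quotient.eq_zero_iff_mem.1 h1

/-- A minimal prime of a positive critical binomial ideal contains no variable. -/
theorem X_notMem_of_mem_minimalPrimes (ha : IsPCB a) (hn : 0 < n)
    {p : Ideal (MvPolynomial (Fin n) k)} (hp : p ∈ (idealI k a).minimalPrimes) (i : Fin n) :
    X i ∉ p := by
  intro hi
  have := hp.1.1
  obtain ⟨m, hm0, hm⟩ := exists_pos_weight ha hn
  -- The monomial curve `x_i ↦ t^{m_i}`. Its kernel is a prime over `I` lying inside the ideal of
  -- all variables, so a minimal prime containing every variable would equal it, although it
  -- contains none.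
  let φ : MvPolynomial (Fin n) k →ₐ[k] Polynomial k := aeval fun i => Polynomial.X ^ m i
  have hq : (RingHom.ker φ).IsPrime := RingHom.ker_isPrime φ
  have hIq : idealI k a ≤ RingHom.ker φ := by
    rw [idealI, Ideal.span_le]
    rintro _ ⟨j, rfl⟩
    change φ (binom k a j) = 0
    simp only [φ, binom, map_sub, map_pow, map_prod, aeval_X, ← pow_mul, Finset.prod_pow_eq_pow_sum,
      ← hm j, sub_self]
  have hqp : RingHom.ker φ ≤ p := fun f hf =>
    mem_of_constantCoeff_eq_zero (X_mem_of_X_mem ha hp.1.2 hi)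
      (aeval_zero_eq_zero_of_mem_ker hm0 hf)
  have h : φ (X i) = 0 := hp.2 ⟨hq, hIq⟩ hqp hi
  rw [aeval_X] at h
  exact pow_ne_zero _ Polynomial.X_ne_zero h

theorem saturation_le_of_isPrimary {I q : Ideal (MvPolynomial (Fin n) k)} (hq : q.IsPrimary)
    (hI : I ≤ q) (hX : ∀ i, X i ∉ q.radical) : saturation I ≤ q := by
  intro f hf
  obtain ⟨N, hN⟩ := mem_saturation_iff.1 hf
  have := Ideal.isPrime_radical hq
  rcases (Ideal.isPrimary_iff.1 hq).2 (mul_comm _ f ▸ hI hN) with h | h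
  · exact h
  · obtain ⟨i, -, hi⟩ := (Ideal.IsPrime.prod_mem_iff (hp := this)).1 (this.mem_of_pow_mem _ h)
    exact absurd hi (hX i)

/-- The polynomial ring modulo the saturation is integral over the polynomials in any one of the
variables. -/
theorem exists_monic_eval₂_mem_saturation (ha : IsPCB a) (hn : 0 < n) (j : Fin n)
    (f : MvPolynomial (Fin n) k) : ∃ P : Polynomial (Polynomial k), P.Monic ∧
      P.eval₂ (Polynomial.aeval (X j : MvPolynomial (Fin n) k)).toRingHom f ∈
        saturation (idealI k a) := by
  set S := saturation (idealI k a)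
  set φ : Polynomial k →+* MvPolynomial (Fin n) k :=
    (Polynomial.aeval (X j : MvPolynomial (Fin n) k)).toRingHom with hφ
  have hφX : ∀ r, φ (Polynomial.X ^ r) = X j ^ r := fun r => by simp [hφ]
  let ψ := (Ideal.Quotient.mk S).comp φ
  have key : ψ.IsIntegralElem (Ideal.Quotient.mk S f) := by
    induction f using MvPolynomial.induction_on with
    | C r =>
      have : Ideal.Quotient.mk S (C r) = ψ (Polynomial.C r) := by
        simp [ψ, hφ, algebraMap_eq]
      rw [this]
      exact ψ.isIntegralElem_map
    | add f g hf hg => rw [map_add]; exact hf.add ψ hg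
    | mul_X f i hf =>
      rw [map_mul]
      refine hf.mul ψ ?_
      obtain ⟨d, e, hd, he, hde⟩ := exists_expClass_single_eq ha hn i j
      have hmem : X i ^ d - X j ^ e ∈ S := by
        rw [mem_saturation_iff_toGroupAlgebra ha hn, map_sub, toGroupAlgebra_X_pow,
          toGroupAlgebra_X_pow, hde, sub_self]
      refine ⟨Polynomial.X ^ d - Polynomial.C (Polynomial.X ^ e),
        Polynomial.monic_X_pow_sub_C _ hd.ne', ?_⟩
      rw [Polynomial.eval₂_sub, Polynomial.eval₂_X_pow, Polynomial.eval₂_C, RingHom.comp_apply,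
        hφX, ← map_pow, ← map_sub]
      exact Ideal.Quotient.eq_zero_iff_mem.2 hmem
  obtain ⟨P, hP, h⟩ := key
  refine ⟨P, hP, Ideal.Quotient.eq_zero_iff_mem.1 ?_⟩
  rw [Polynomial.hom_eval₂]
  exact h

/-- A nonzero polynomial in one of the variables is not a zero divisor modulo the saturation. -/
theorem mem_saturation_of_aeval_X_mul_mem (ha : IsPCB a) (hn : 0 < n) (j : Fin n)
    {h : Polynomial k} (hh : h ≠ 0) {g : MvPolynomial (Fin n) k}
    (hg : Polynomial.aeval (X j : MvPolynomial (Fin n) k) h * g ∈ saturation (idealI k a)) :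
    g ∈ saturation (idealI k a) := by
  rw [mem_saturation_iff_toGroupAlgebra ha hn] at hg ⊢
  obtain ⟨deg, hdeg⟩ := exists_degree ha hn
  refine eq_zero_of_aeval_single_mul_eq_zero deg (hdeg j) hh ?_
  rwa [map_mul, ← Polynomial.aeval_algHom_apply, toGroupAlgebra, aeval_X] at hg

/-- An associated prime of a positive critical binomial ideal that contains no variable is a
minimal prime. -/
theorem mem_minimalPrimes_of_mem_associatedPrimes (ha : IsPCB a) (hn : 0 < n)
    {p : Ideal (MvPolynomial (Fin n) k)} (hp : p ∈ (idealI k a).associatedPrimes)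
    (hX : ∀ i, X i ∉ p) : p ∈ (idealI k a).minimalPrimes := by
  obtain ⟨hprime, g, hpg⟩ := hp
  have hIp : idealI k a ≤ p := by
    rw [hpg]
    refine le_trans (fun f hf => ?_) Ideal.le_radical
    rw [Submodule.mem_colon_singleton]
    exact Ideal.mul_mem_right _ _ hf
  have hgS : g ∉ saturation (idealI k a) := by
    intro hg
    obtain ⟨N, hN⟩ := mem_saturation_iff.1 hg
    have h1 : (∏ i, X i : MvPolynomial (Fin n) k) ^ N ∈ p := by
      rw [hpg]
      exact Ideal.le_radical (Submodule.mem_colon_singleton.2 hN)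
    obtain ⟨i, -, hi⟩ := (Ideal.IsPrime.prod_mem_iff (hp := hprime)).1
      (hprime.mem_of_pow_mem _ h1)
    exact hX i hi
  refine ⟨⟨hprime, hIp⟩, fun q ⟨hq, hIq⟩ hqp => ?_⟩
  by_contra hpq
  obtain ⟨f, hfp, hfq⟩ := SetLike.not_le_iff_exists.1 hpq
  have hSq : saturation (idealI k a) ≤ q := saturation_le_of_isPrimary hq.isPrimary hIq
    fun i hi => hX i (hqp (hq.radical ▸ hi))
  let j : Fin n := ⟨0, hn⟩
  obtain ⟨P, hP, hPf⟩ := exists_monic_eval₂_mem_saturation ha hn j f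
  -- By integrality the strict inclusion `q < p` survives contraction to `k[x_j]`, so `p` contains
  -- some nonzero `h(x_j)`. A power of it times `g` lies in `I`, forcing `g` into the saturation.
  have hlt := Ideal.comap_lt_comap_of_root_mem_sdiff hqp ⟨hfp, hfq⟩
    (Polynomial.map_monic_ne_zero hP) (hSq hPf)
  obtain ⟨-, h, hh, hhq⟩ := SetLike.lt_iff_le_and_exists.1 hlt
  have hh0 : h ≠ 0 := fun h0 => hhq (h0 ▸ zero_mem _)
  rw [Ideal.mem_comap, hpg] at hh
  obtain ⟨r, hr⟩ := hh
  rw [Submodule.mem_colon_singleton, smul_eq_mul, ← map_pow] at hr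
  exact hgS (mem_saturation_of_aeval_X_mul_mem ha hn j (pow_ne_zero r hh0)
    (mem_saturation_iff.2 ⟨0, by simpa using hr⟩))

theorem saturation_eq_hull (ha : IsPCB a) (hn : 0 < n) :
    saturation (idealI k a) = hull (idealI k a) := by
  refine le_antisymm (le_sInf ?_) fun f hf => ?_
  · rintro q ⟨⟨t, ht, hqt⟩, hq⟩
    refine saturation_le_of_isPrimary (ht.primary hqt) ?_
      (X_notMem_of_mem_minimalPrimes ha hn hq)
    rw [← ht.inf_eq]
    exact Finset.inf_le hqt
  · obtain ⟨t, ht⟩ := Submodule.IsLasker.exists_isMinimalPrimaryDecomposition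
      (Submodule.isLasker (MvPolynomial (Fin n) k) (MvPolynomial (Fin n) k)) (idealI k a)
    have key : ∀ q : Ideal (MvPolynomial (Fin n) k), q ∈ t → ∃ N : ℕ,
        (∏ i, X i : MvPolynomial (Fin n) k) ^ N * f ∈ q := by
      intro q hqt
      by_cases hX : ∀ i, X i ∉ q.radical
      · refine ⟨0, ?_⟩
        rw [pow_zero, one_mul]
        refine (Submodule.mem_sInf.1 hf) q ⟨⟨t, ht, hqt⟩,
          mem_minimalPrimes_of_mem_associatedPrimes ha hn ?_ hX⟩
        rw [← ht.image_radical_eq_associated_primes]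
        exact ⟨q, hqt, by simp only [Submodule.colon_univ]⟩
      · obtain ⟨i, hi⟩ := not_forall_not.1 hX
        obtain ⟨N, hN⟩ : (∏ i, X i : MvPolynomial (Fin n) k) ∈ q.radical :=
          Ideal.mem_of_dvd _ (Finset.dvd_prod_of_mem _ (Finset.mem_univ i)) hi
        exact ⟨N, Ideal.mul_mem_right _ _ hN⟩
    choose! N hN using key
    rw [mem_saturation_iff]
    -- The sum bounds every `N q`, so a single power works for all components.
    refine ⟨∑ q ∈ t, N q, ?_⟩
    rw [← ht.inf_eq, Submodule.mem_finsetInf]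
    intro q hqt
    exact Ideal.mem_of_dvd _ (mul_dvd_mul_right (pow_dvd_pow _
      (Finset.single_le_sum (fun _ _ => Nat.zero_le _) hqt)) f) (hN q hqt)

end

end PCB

theorem proposition4p4 {k : Type*} [Field k] (n : ℕ) (hn : 2 ≤ n)
    (a : Matrix (Fin n) (Fin n) ℕ) (ha : PCB.IsPCB a) :
    PCB.saturation (PCB.idealI k a) = PCB.hull (PCB.idealI k a) ∧
      PCB.saturation (PCB.idealI k a) =
        (PCB.idealI k a).colon {PCB.monom k (PCB.bLast a)} ∧
      PCB.saturation (PCB.idealI k a) =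
        (PCB.idealJ k a).colon {PCB.monom k (PCB.bLast a)} :=
  ⟨PCB.saturation_eq_hull ha (by omega), PCB.saturation_eq_colon_idealI ha (by omega),
    PCB.saturation_eq_colon_idealJ ha (by omega)⟩
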